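/- Let $\mathcal{C}$ be a Krull–Schmidt triangulated category with suspension functor $\Sigma$, and write $\operatorname{Ext}^1_{\mathcal{C}}(X,Y)=\operatorname{Hom}_{\mathcal{C}}(X,\Sigma Y)$. All subcategories below are full. For subcategories $\mathcal{A},\mathcal{B}$ of $\mathcal{C}$, let $\mathcal{A}*\mathcal{B}$ be the subcategory of all $X$ for which there is a distinguished triangle $A\to X\to B\to\Sigma A$ with $A\in\mathcal{A}$, $B\in\mathcal{B}$, and let $[\mathcal{A}]$ denote the ideal of morphisms factoring through an object of $\mathcal{A}$. A cotorsion pair $(\mathcal{U},\mathcal{V})$ on $\mathcal{C}$ consists of two additive subcategories closed under isomorphisms and direct summands such that $\operatorname{Ext}^1_{\mathcal{C}}(\mathcal{U},\mathcal{V})=0$ and $\mathcal{C}=\mathcal{U}*\Sigma\mathcal{V}$; its heart is $\overline{\mathscr{H}}_{(\mathcal{U},\mathcal{V})}=\big((\Sigma^{-1}\mathcal{U}*\mathscr{W})\cap(\mathscr{W}*\Sigma\mathcal{V})\big)/[\mathscr{W}]$ with $\mathscr{W}=\mathcal{U}\cap\mathcal{V}$. A twin cotorsion pair $((\mathcal{S},\mathcal{T}),(\mathcal{U},\mathcal{V}))$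 consists of two cotorsion pairs with $\operatorname{Ext}^1_{\mathcal{C}}(\mathcal{S},\mathcal{V})=0$; its heart is $\overline{\mathcal{H}}=\mathcal{H}/[\mathcal{W}]$ with $\mathcal{W}=\mathcal{T}\cap\mathcal{U}$ and $\mathcal{H}=(\Sigma^{-1}\mathcal{S}*\mathcal{W})\cap(\mathcal{W}*\Sigma\mathcal{V})$. Let $((\mathcal{S},\mathcal{T}),(\mathcal{U},\mathcal{V}))$ be a twin cotorsion pair on $\mathcal{C}$ with $\mathcal{T}=\mathcal{U}$, and let $\mathcal{R}$ be the class of regular (that is, simultaneously monic and epic) morphisms of its heart $\overline{\mathcal{H}}$. Then $\mathcal{W}=\mathcal{T}$ and $\mathcal{H}=\mathcal{C}$, so $\overline{\mathcal{H}}=\mathcal{C}/[\mathcal{W}]$; moreover $\mathcal{S}\cap\mathcal{T}=\mathcal{S}$ and the heart of $(\mathcal{S},\mathcal{T})$ is $\overline{\mathscr{H}}_{(\mathcal{S},\mathcal{T})}=(\Sigma^{-1}\mathcal{S}*\mathcal{S})/[\mathcal{S}]$. The Gabriel–Zisman localisation $\overline{\mathcal{H}}_{\mathcal{R}}$ is equivalent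 to $\overline{\mathscr{H}}_{(\mathcal{S},\mathcal{T})}$. Explicitly, if $F\colon\overline{\mathscr{H}}_{(\mathcal{S},\mathcal{T})}\to\overline{\mathcal{H}}$ is the canonical functor, which is the identity on objects and sends the coset of $f$ modulo $[\mathcal{S}]$ to the coset of $f$ modulo $[\mathcal{W}]$, and $L_{\mathcal{R}}\colon\overline{\mathcal{H}}\to\overline{\mathcal{H}}_{\mathcal{R}}$ is the localisation functor, then $L_{\mathcal{R}}\circ F$ is an equivalence of categories. -/

import Mathlib

open CategoryTheory CategoryTheory.Limits CategoryTheory.Pretriangulated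

universe v u

namespace TwinCotorsion

section Basic

variable (C : Type u) [Category.{v} C] [Preadditive C]

/-- Every object is a finite direct sum (possibly empty) of objects with local
endomorphism rings. For an additive category this is the Krull-Schmidt property. -/
def IsKrullSchmidt : Prop :=
  ∀ X : C, ∃ (n : ℕ) (F : Fin n → C) (b : Bicone F),
    Nonempty b.IsBilimit ∧ Nonempty (b.pt ≅ X) ∧ ∀ i, IsLocalRing (End (F i))

variable {C}

/-- A full additive subcategory closed under isomorphisms and direct summands. -/
structure IsAdditiveSubcategory [HasBinaryBiproducts C] (P : ObjectProperty C) : Prop where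
  zero : ∀ X : C, IsZero X → P X
  iso : ∀ X Y : C, Nonempty (X ≅ Y) → P X → P Y
  biprod : ∀ X Y : C, P X → P Y → P (X ⊞ Y)
  summand : ∀ X Y : C, P (X ⊞ Y) → P X

/-- The morphism `f` factors through an object of `W`, i.e. `f` lies in the ideal `[W]`. -/
def FactorsThrough (W : ObjectProperty C) {X Y : C} (f : X ⟶ Y) : Prop :=
  ∃ (A : C) (_ : W A) (a : X ⟶ A) (b : A ⟶ Y), a ≫ b = f

/-- Congruence modulo the ideal `[W]` on the full subcategory of `C` given by `P`. -/
def idealRel (P W : ObjectProperty C) : HomRel P.FullSubcategory :=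
  fun _ _ f g => FactorsThrough W (f.hom - g.hom)

/-- The subfactor category `P / [W]` (for `W ⊆ P` an additive subcategory): its objects are
those of `P`, its morphisms are those of `C` modulo the ideal `[W]`. -/
abbrev Subfactor (P W : ObjectProperty C) : Type u :=
  CategoryTheory.Quotient (idealRel P W)

/-- If `P ⊆ P'` and `W ⊆ W'`, the canonical functor `P / [W] ⥤ P' / [W']`: it is the identity on
objects and sends the coset of `f` modulo `[W]` to the coset of `f` modulo `[W']`. -/
def subfactorFunctor {P P' W W' : ObjectProperty C} (hP : P ≤ P') (hW : W ≤ W') :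
    Subfactor P W ⥤ Subfactor P' W' :=
  CategoryTheory.Quotient.lift (idealRel P W)
    (ObjectProperty.ιOfLE hP ⋙ CategoryTheory.Quotient.functor (idealRel P' W'))
    (fun X Y f g h => by
      obtain ⟨A, hA, a, b, hab⟩ := h
      exact CategoryTheory.Quotient.sound (idealRel P' W')
        (f₁ := (ObjectProperty.ιOfLE hP).map f) (f₂ := (ObjectProperty.ιOfLE hP).map g)
        ⟨A, hW A hA, a, b, hab⟩)

/-- The class of regular morphisms of a category: those that are both monic and epic. -/
def regularMorphisms (D : Type u) [Category.{v} D] : MorphismProperty D :=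
  MorphismProperty.monomorphisms D ⊓ MorphismProperty.epimorphisms D

end Basic

section Triangulated

variable {C : Type u} [Category.{v} C] [Preadditive C] [HasZeroObject C] [HasShift C ℤ]
  [∀ n : ℤ, (shiftFunctor C n).Additive] [Pretriangulated C]

/-- The subcategory `Σⁿ P`, closed under isomorphisms. -/
def susp (n : ℤ) (P : ObjectProperty C) : ObjectProperty C :=
  P.map (shiftFunctor C n)

/-- `P * Q`: the objects `X` lying in a distinguished triangle `A ⟶ X ⟶ B ⟶ ΣA` with
`A` in `P` and `B` in `Q`. -/
abbrev star (P Q : ObjectProperty C) : ObjectProperty C :=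
  ObjectProperty.extensionProduct P Q

/-- `Ext¹(P, Q) = 0`, where `Ext¹(X, Y) = Hom(X, ΣY)`. -/
def ExtOneVanishes (P Q : ObjectProperty C) : Prop :=
  ∀ (X Y : C), P X → Q Y → ∀ f : X ⟶ Y⟦(1 : ℤ)⟧, f = 0

/-- `(U, V)` is a cotorsion pair on the triangulated category `C`. -/
structure IsCotorsionPair (U V : ObjectProperty C) : Prop where
  left : IsAdditiveSubcategory U
  right : IsAdditiveSubcategory V
  ext : ExtOneVanishes U V
  star_eq : star U (susp 1 V) = ⊤

/-- `((S, T), (U, V))` is a twin cotorsion pair on the triangulated category `C`. -/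
structure IsTwinCotorsionPair (S T U V : ObjectProperty C) : Prop where
  fst : IsCotorsionPair S T
  snd : IsCotorsionPair U V
  ext : ExtOneVanishes S V

/-- `𝓦 = T ∩ U` for a twin cotorsion pair `((S, T), (U, V))`. -/
def twinW (T U : ObjectProperty C) : ObjectProperty C := T ⊓ U

/-- `𝓗 = C⁻ ∩ C⁺`, where `C⁻ = Σ⁻¹S * 𝓦` and `C⁺ = 𝓦 * ΣV`, for a twin cotorsion
pair `((S, T), (U, V))`. -/
def twinH (S T U V : ObjectProperty C) : ObjectProperty C :=
  star (susp (-1) S) (twinW T U) ⊓ star (twinW T U) (susp 1 V)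

/-- The heart `𝓗 / [𝓦]` of a twin cotorsion pair `((S, T), (U, V))`. -/
abbrev TwinHeart (S T U V : ObjectProperty C) : Type u :=
  Subfactor (twinH S T U V) (twinW T U)

/-- `U ∩ V` for a single cotorsion pair `(U, V)`. -/
def pairW (U V : ObjectProperty C) : ObjectProperty C := U ⊓ V

/-- `(Σ⁻¹U * (U ∩ V)) ∩ ((U ∩ V) * ΣV)` for a single cotorsion pair `(U, V)`. -/
def pairH (U V : ObjectProperty C) : ObjectProperty C :=
  star (susp (-1) U) (pairW U V) ⊓ star (pairW U V) (susp 1 V)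

/-- The heart of a single cotorsion pair `(U, V)`. -/
abbrev PairHeart (U V : ObjectProperty C) : Type u :=
  Subfactor (pairH U V) (pairW U V)

end Triangulated

end TwinCotorsion

/-! Since `T = U` is the full left Ext-orthogonal of `V`, the vanishing of `Ext¹(S, V)` gives `S ≤
T`, and both factors of `𝓗` become `C`. From `Hom(Σ⁻¹S, T) = 0` and `C = Σ⁻¹S * T`, a morphism dies
in `C/[T]` iff every map from `Σ⁻¹S` composes with it to zero (`factorsThrough_iff`). Hence regular
morphisms are those bijective on `Hom(Σ⁻¹S, -)` (`regularMorphisms_iff`). Objects of `Σ⁻¹S * S` are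
colocal for these (`exists_lift_of_homBijective`) and cover every object (`exists_homBijective`), so
they form a coreflective subcategory of `C/[T]` whose coreflector inverts regular morphisms;
localising then recovers it (`isEquivalence_comp_Q_of_colocal`). -/

namespace TwinCotorsion

/-! ### Localisation at a coreflective subcategory -/

section Colocalization

universe v₁ v₂ u₁ u₂

/-- A fully faithful functor whose objects are colocal with respect to `W`, and such that every
object is the target of a morphism of `W` from its image, becomes an equivalence after
localisation at `W`. -/
lemma isEquivalence_comp_Q_of_colocal {D : Type u₁} {E : Type u₂} [Category.{v₁} D]
    [Category.{v₂} E] (F : D ⥤ E) [F.Full] [F.Faithful] (W : MorphismProperty E)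
    (hcolocal : ∀ (X : D) {Y Y' : E} (f : Y ⟶ Y'), W f →
      Function.Bijective (fun g : F.obj X ⟶ Y => g ≫ f))
    (hcover : ∀ Y : E, ∃ (X : D) (c : F.obj X ⟶ Y), W c) :
    (F ⋙ W.Q).IsEquivalence := by
  have hterm : ∀ Y : E, HasTerminal (CostructuredArrow F Y) := by
    intro Y
    obtain ⟨X, c, hc⟩ := hcover Y
    -- Colocality against `c` itself makes `c` terminal over `Y`; these terminal objects assemble
    -- into a right adjoint of `F`.
    have huniq : ∀ Z : CostructuredArrow F Y, Nonempty (Unique (Z ⟶ CostructuredArrow.mk c)) := by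
      intro Z
      obtain ⟨g, hg⟩ := (hcolocal Z.left c hc).2 Z.hom
      refine ⟨⟨⟨CostructuredArrow.homMk (F.preimage g) (by simpa using hg)⟩, fun k => ?_⟩⟩
      apply CostructuredArrow.hom_ext
      apply F.map_injective
      apply (hcolocal Z.left c hc).1
      have := CostructuredArrow.w k
      simp only [CostructuredArrow.homMk_left, Functor.map_preimage]
      exact this.trans hg.symm
    have (Z : CostructuredArrow F Y) : Unique (Z ⟶ CostructuredArrow.mk c) := (huniq Z).some
    exact hasTerminal_of_unique (CostructuredArrow.mk c)
  have : F.IsLeftAdjoint := isLeftAdjoint_of_costructuredArrowTerminals F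
  let G := F.rightAdjoint
  let adj : F ⊣ G := Adjunction.ofIsLeftAdjoint F
  have hG : W.IsInvertedBy G := by
    intro Y Y' f hf
    rw [isIso_iff_yoneda_map_bijective]
    intro X
    have hcomp : (fun x : X ⟶ G.obj Y => x ≫ G.map f) =
        (adj.homEquiv X Y') ∘ (fun g => g ≫ f) ∘ (adj.homEquiv X Y).symm := by
      funext x
      simp [Adjunction.homEquiv_naturality_right]
    rw [hcomp]
    exact (Equiv.bijective _).comp ((hcolocal X f hf).comp (Equiv.bijective _))
  have hcounit (Y : E) : IsIso (W.Q.map (adj.counit.app Y)) := by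
    obtain ⟨X, c, hc⟩ := hcover Y
    have h₁ : IsIso (G.map c) := hG c hc
    have h₂ : IsIso (W.Q.map c) := Localization.inverts W.Q W c hc
    -- The counit at `F.obj X` is invertible because `F` is fully faithful; naturality along `c`
    -- transfers this to `Y` after applying `W.Q`.
    have h₃ := adj.counit.naturality c
    have h₄ : W.Q.map (F.map (G.map c)) ≫ W.Q.map (adj.counit.app Y) =
        W.Q.map (adj.counit.app (F.obj X)) ≫ W.Q.map c := by
      rw [← W.Q.map_comp, ← W.Q.map_comp]
      exact congrArg W.Q.map h₃
    have h₅ : IsIso (W.Q.map (F.map (G.map c)) ≫ W.Q.map (adj.counit.app Y)) := by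
      rw [h₄]
      infer_instance
    exact IsIso.of_isIso_comp_left (W.Q.map (F.map (G.map c))) _
  have : ∀ Y : E, IsIso ((Functor.whiskerRight adj.counit W.Q).app Y) := hcounit
  have : IsIso (Functor.whiskerRight adj.counit W.Q) := NatIso.isIso_of_isIso_app _
  let e : D ≌ W.Localization := CategoryTheory.Equivalence.mk (F ⋙ W.Q) (Localization.lift G hG W.Q)
    (asIso adj.unit ≪≫ Functor.isoWhiskerLeft F (Localization.fac G hG W.Q).symm ≪≫
      (Functor.associator _ _ _).symm)
    (Localization.liftNatIso W.Q W (G ⋙ F ⋙ W.Q) W.Q _ _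
      (asIso (Functor.whiskerRight adj.counit W.Q)))
  exact e.isEquivalence_functor

end Colocalization

/-! ### Ideals and subfactor categories -/

section Ideal

variable {C : Type u} [Category.{v} C]

lemma FactorsThrough.comp_left {W : ObjectProperty C} {X Y Z : C} (g : X ⟶ Y) {f : Y ⟶ Z}
    (h : FactorsThrough W f) : FactorsThrough W (g ≫ f) := by
  obtain ⟨A, hA, a, b, rfl⟩ := h
  exact ⟨A, hA, g ≫ a, b, by simp⟩

lemma FactorsThrough.comp_right {W : ObjectProperty C} {X Y Z : C} {f : X ⟶ Y} (g : Y ⟶ Z)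
    (h : FactorsThrough W f) : FactorsThrough W (f ≫ g) := by
  obtain ⟨A, hA, a, b, rfl⟩ := h
  exact ⟨A, hA, a, b ≫ g, by simp⟩

variable [Preadditive C]

lemma FactorsThrough.of_isZero {W : ObjectProperty C} {X Y Z : C} (hW : W Z) :
    FactorsThrough W (0 : X ⟶ Y) :=
  ⟨Z, hW, 0, 0, by simp⟩

lemma FactorsThrough.neg {W : ObjectProperty C} {X Y : C} {f : X ⟶ Y}
    (h : FactorsThrough W f) : FactorsThrough W (-f) := by
  obtain ⟨A, hA, a, b, rfl⟩ := h
  exact ⟨A, hA, a, -b, by simp⟩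

variable [HasBinaryBiproducts C]

lemma FactorsThrough.add {W : ObjectProperty C} (hW : IsAdditiveSubcategory W) {X Y : C}
    {f g : X ⟶ Y} (hf : FactorsThrough W f) (hg : FactorsThrough W g) :
    FactorsThrough W (f + g) := by
  obtain ⟨A, hA, a, b, rfl⟩ := hf
  obtain ⟨A', hA', a', b', rfl⟩ := hg
  exact ⟨A ⊞ A', hW.biprod _ _ hA hA', biprod.lift a a', biprod.desc b b', by simp⟩

lemma congruence_idealRel [HasZeroObject C] (P : ObjectProperty C) {W : ObjectProperty C}
    (hW : IsAdditiveSubcategory W) : Congruence (idealRel P W) where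
  comp_left f g g' h := by
    have := FactorsThrough.comp_left f.hom h
    rwa [Preadditive.comp_sub] at this
  comp_right g h := by
    have := FactorsThrough.comp_right g.hom h
    rwa [Preadditive.sub_comp] at this
  equivalence :=
    { refl := fun f => by
        change FactorsThrough W _
        rw [sub_self]
        exact .of_isZero (hW.zero _ (isZero_zero C))
      symm := fun {f g} h => by
        have := FactorsThrough.neg h
        rwa [neg_sub] at this
      trans := fun {f g k} h h' => by
        have := FactorsThrough.add hW h h'
        rwa [sub_add_sub_cancel] at this }

/-- The projection onto the subfactor category. -/
abbrev proj (P W : ObjectProperty C) : P.FullSubcategory ⥤ Subfactor P W :=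
  CategoryTheory.Quotient.functor (idealRel P W)

lemma proj_map_eq_iff [HasZeroObject C] {P W : ObjectProperty C}
    (hW : IsAdditiveSubcategory W) {X Y : P.FullSubcategory} (f g : X ⟶ Y) :
    (proj P W).map f = (proj P W).map g ↔ FactorsThrough W (f.hom - g.hom) := by
  have := congruence_idealRel P hW
  exact CategoryTheory.Quotient.functor_map_eq_iff _ f g

end Ideal

/-! ### Cotorsion pairs and regular morphisms -/

section Rigid

variable {C : Type u} [Category.{v} C] [Preadditive C] [HasZeroObject C] [HasShift C ℤ]
  [∀ n : ℤ, (shiftFunctor C n).Additive] [Pretriangulated C] {S T U V : ObjectProperty C}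

/-- The first term of a cotorsion pair contains every `X` with `Ext¹(X, V) = 0`. -/
lemma IsCotorsionPair.left_of_ext (h : IsCotorsionPair U V) {X : C}
    (hX : ∀ Y, V Y → ∀ f : X ⟶ Y⟦(1 : ℤ)⟧, f = 0) : U X := by
  have hstar : star U (susp 1 V) X := by rw [h.star_eq]; trivial
  obtain ⟨A, B, f, g, k, hT, hA, Y, hY, ⟨e⟩⟩ := hstar
  -- With `g = 0` the triangle splits, so `X` is a summand of `A`.
  have hg : g = 0 := by
    have := hX Y hY (g ≫ e.inv)
    rw [← cancel_mono e.inv, this, zero_comp]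
  obtain ⟨i, -, -⟩ := exists_iso_binaryBiproduct_of_distTriang _
    (inv_rot_of_distTriang _ hT) (by
      rw [Triangle.invRotate_mor₃, show (Triangle.mk f g k).mor₂ = 0 from hg]
      exact zero_comp)
  have hb := h.left.iso _ _ ⟨i⟩ hA
  exact h.left.summand _ _ (h.left.iso _ _ ⟨biprod.braiding _ _⟩ hb)

lemma shift_of_susp_neg_one {P : ObjectProperty C} (hP : IsAdditiveSubcategory P) {X : C}
    (hX : susp (-1) P X) : P (X⟦(1 : ℤ)⟧) := by
  obtain ⟨A, hA, ⟨e⟩⟩ := hX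
  exact hP.iso _ _ ⟨(shiftEquiv C (1 : ℤ)).counitIso.symm.app A ≪≫
    (shiftFunctor C (1 : ℤ)).mapIso e⟩ hA

/-- `Hom(Σ⁻¹S, T) = 0` for a cotorsion pair `(S, T)`. -/
lemma IsCotorsionPair.hom_eq_zero (h : IsCotorsionPair S T) {X Y : C} (hX : susp (-1) S X)
    (hY : T Y) (f : X ⟶ Y) : f = 0 := by
  apply (shiftFunctor C (1 : ℤ)).map_injective
  rw [Functor.map_zero]
  exact h.ext _ _ (shift_of_susp_neg_one h.left hX) hY _

/-- `C = Σ⁻¹S * T` for a cotorsion pair `(S, T)`. -/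
lemma IsCotorsionPair.star_susp_neg_one (h : IsCotorsionPair S T) (Y : C) :
    star (susp (-1) S) T Y := by
  have hstar : star S (susp 1 T) (Y⟦(1 : ℤ)⟧) := by rw [h.star_eq]; trivial
  obtain ⟨A, B, f, g, k, hT, hA, Z, hZ, ⟨e⟩⟩ := hstar
  have hT' := Triangle.shift_distinguished _ hT (-1)
  have i : (Y⟦(1 : ℤ)⟧)⟦(-1 : ℤ)⟧ ≅ Y := ((shiftEquiv C (1 : ℤ)).unitIso.app Y).symm
  have j : B⟦(-1 : ℤ)⟧ ≅ Z := (shiftFunctor C (-1 : ℤ)).mapIso e.symm ≪≫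
    ((shiftEquiv C (1 : ℤ)).unitIso.app Z).symm
  refine (star (susp (-1) S) T).prop_of_iso i ?_
  exact ⟨_, _, _, _, _, hT', ObjectProperty.prop_map_obj _ _ hA, h.right.iso _ _ ⟨j.symm⟩ hZ⟩

/-- In a triangle `X ⟶ Y ⟶ B` with `X` in `Σ⁻¹S` and `B` in `T`, a morphism out of `Y` that vanishes
on `X` extends over `B`. -/
lemma IsCotorsionPair.factorsThrough_iff (h : IsCotorsionPair S T) {Y Z : C} (f : Y ⟶ Z) :
    FactorsThrough T f ↔ ∀ (X : C) (_ : susp (-1) S X) (a : X ⟶ Y), a ≫ f = 0 := by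
  constructor
  · rintro ⟨A, hA, a, b, rfl⟩ X hX c
    rw [← Category.assoc, h.hom_eq_zero hX hA (c ≫ a), zero_comp]
  · intro hf
    obtain ⟨X, B, u, w, k, hT, hX, hB⟩ := h.star_susp_neg_one Y
    obtain ⟨b, hb⟩ := Triangle.yoneda_exact₂ _ hT f (hf X hX u)
    exact ⟨B, hB, w, b, hb.symm⟩

/-- A morphism out of `Σ⁻¹S * S` factoring through `T` factors through `S`. -/
lemma IsCotorsionPair.factorsThrough_of_star (h : IsCotorsionPair S T) {X Y : C}
    (hX : star (susp (-1) S) S X) {f : X ⟶ Y} (hf : FactorsThrough T f) :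
    FactorsThrough S f := by
  obtain ⟨X₀, B, u, w, k, hT, hX₀, hB⟩ := hX
  obtain ⟨b, hb⟩ := Triangle.yoneda_exact₂ _ hT f ((h.factorsThrough_iff f).1 hf X₀ hX₀ u)
  exact ⟨B, hB, w, b, hb.symm⟩

/-- The morphism `f` induces an isomorphism on `Hom(X, -)` for all `X` in `R`. -/
def HomBijective (R : ObjectProperty C) {Y Z : C} (f : Y ⟶ Z) : Prop :=
  ∀ X, R X → Function.Bijective (fun a : X ⟶ Y => a ≫ f)

/-- Every object receives from an object of `Σ⁻¹S * S` a morphism inducing isomorphisms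
on `Hom(Σ⁻¹S, -)`. -/
lemma IsCotorsionPair.exists_homBijective (h : IsCotorsionPair S T) (hST : S ≤ T) (Y : C) :
    ∃ (X : C) (c : X ⟶ Y), star (susp (-1) S) S X ∧ HomBijective (susp (-1) S) c := by
  obtain ⟨X₀, B, u, w, k, hT, hX₀, hB⟩ := h.star_susp_neg_one Y
  -- A two-term presentation of `Y`: `u` covers it by `Σ⁻¹S`, `u'` covers the fibre `K` of `u`, and
  -- `X` is the cone of `X₁ ⟶ X₀`.
  obtain ⟨K, d, l, hK⟩ := distinguished_cocone_triangle₁ u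
  obtain ⟨X₁, B', u', w', k', hT', hX₁, hB'⟩ := h.star_susp_neg_one K
  obtain ⟨X, p, q, hX⟩ := distinguished_cocone_triangle (u' ≫ d)
  have hdu : d ≫ u = 0 := comp_distTriang_mor_zero₁₂ _ hK
  obtain ⟨c, hc⟩ : ∃ c : X ⟶ Y, u = p ≫ c := Triangle.yoneda_exact₂ _ hX u
    (show (u' ≫ d) ≫ u = 0 by rw [Category.assoc, hdu, comp_zero])
  have hSX₁ : S (X₁⟦(1 : ℤ)⟧) := shift_of_susp_neg_one h.left hX₁
  refine ⟨X, c, ⟨X₀, X₁⟦(1 : ℤ)⟧, p, q, _, rot_of_distTriang _ hX, hX₀, hSX₁⟩,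
    fun Z hZ => ⟨?_, fun a => ?_⟩⟩
  · intro a a' haa
    rw [← sub_eq_zero]
    have hb : (a - a') ≫ c = 0 := by
      rw [Preadditive.sub_comp, sub_eq_zero]
      exact haa
    obtain ⟨b, hb'⟩ : ∃ b : Z ⟶ X₀, a - a' = b ≫ p := Triangle.coyoneda_exact₂ _
      (rot_of_distTriang _ hX) (a - a') (h.hom_eq_zero hZ (hST _ hSX₁) _)
    rw [hb', Category.assoc, ← hc] at hb
    obtain ⟨b₁, rfl⟩ : ∃ b₁ : Z ⟶ K, b = b₁ ≫ d := Triangle.coyoneda_exact₂ _ hK b hb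
    obtain ⟨b₂, rfl⟩ : ∃ b₂ : Z ⟶ X₁, b₁ = b₂ ≫ u' :=
      Triangle.coyoneda_exact₂ _ hT' b₁ (h.hom_eq_zero hZ hB' _)
    have hz : (u' ≫ d) ≫ p = 0 := comp_distTriang_mor_zero₁₂ _ hX
    rw [hb', Category.assoc, Category.assoc, ← Category.assoc u', hz, comp_zero]
  · obtain ⟨b, rfl⟩ : ∃ b : Z ⟶ X₀, a = b ≫ u :=
      Triangle.coyoneda_exact₂ _ hT a (h.hom_eq_zero hZ hB _)
    exact ⟨b ≫ p, by simp [hc]⟩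

/-- Morphisms out of `Σ⁻¹S * S` lift, modulo `[T]`, along morphisms inducing isomorphisms
on `Hom(Σ⁻¹S, -)`. -/
lemma exists_lift_of_homBijective (hST : S ≤ T) {X Y Z : C}
    (hX : star (susp (-1) S) S X) {f : Y ⟶ Z} (hf : HomBijective (susp (-1) S) f)
    (m : X ⟶ Z) : ∃ l : X ⟶ Y, FactorsThrough T (l ≫ f - m) := by
  obtain ⟨X₀, B, u, w, k, hT, hX₀, hB⟩ := hX
  have hT₁ := inv_rot_of_distTriang _ hT
  have hX₁ : susp (-1) S (B⟦(-1 : ℤ)⟧) := ObjectProperty.prop_map_obj _ _ hB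
  obtain ⟨a, ha : a ≫ f = u ≫ m⟩ := (hf X₀ hX₀).2 (u ≫ m)
  let d : B⟦(-1 : ℤ)⟧ ⟶ X₀ := (Triangle.mk u w k).invRotate.mor₁
  have hdu : d ≫ u = 0 := comp_distTriang_mor_zero₁₂ _ hT₁
  -- Injectivity of `f` on maps from `Σ⁻¹B` lets `a` extend to `l` on `X`; the error `l ≫ f - m`
  -- then kills `u` and factors through `B`.
  have hda : d ≫ a = 0 := by
    apply (hf _ hX₁).1
    dsimp only
    rw [Category.assoc, ha, ← Category.assoc, hdu, zero_comp, zero_comp]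
  obtain ⟨l, hl⟩ : ∃ l : X ⟶ Y, a = u ≫ l := Triangle.yoneda_exact₂ _ hT₁ a hda
  obtain ⟨b, hb⟩ : ∃ b : B ⟶ Z, l ≫ f - m = w ≫ b := Triangle.yoneda_exact₂ _ hT (l ≫ f - m)
    (by
      change u ≫ (l ≫ f - m) = 0
      rw [Preadditive.comp_sub, ← Category.assoc, ← hl, ha, sub_self])
  exact ⟨l, B, hST _ hB, w, b, hb.symm⟩

/-- The regular morphisms of `C / [T]` are those inducing isomorphisms on `Hom(Σ⁻¹S, -)`. -/
lemma IsCotorsionPair.regularMorphisms_iff (h : IsCotorsionPair S T) {P : ObjectProperty C}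
    (hP : P = ⊤) {Y Z : P.FullSubcategory} (f : Y ⟶ Z) :
    regularMorphisms (Subfactor P T) ((proj P T).map f) ↔ HomBijective (susp (-1) S) f.hom := by
  have hP' (X : C) : P X := by rw [hP]; trivial
  have hcomp {X : P.FullSubcategory} {g g' : X ⟶ Y} :
      (proj P T).map g ≫ (proj P T).map f = (proj P T).map g' ≫ (proj P T).map f ↔
        FactorsThrough T ((g.hom - g'.hom) ≫ f.hom) := by
    rw [← Functor.map_comp, ← Functor.map_comp, proj_map_eq_iff h.right]
    simp
  have hcomp' {X : P.FullSubcategory} {g g' : Z ⟶ X} :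
      (proj P T).map f ≫ (proj P T).map g = (proj P T).map f ≫ (proj P T).map g' ↔
        FactorsThrough T (f.hom ≫ (g.hom - g'.hom)) := by
    rw [← Functor.map_comp, ← Functor.map_comp, proj_map_eq_iff h.right]
    simp
  constructor
  · rintro ⟨hmono : Mono _, hepi : Epi _⟩ X hX
    constructor
    · intro a a' (haa : a ≫ f.hom = a' ≫ f.hom)
      let b : (⟨X, hP' X⟩ : P.FullSubcategory) ⟶ Y := ObjectProperty.homMk a
      let b' : (⟨X, hP' X⟩ : P.FullSubcategory) ⟶ Y := ObjectProperty.homMk a'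
      have hbb : (proj P T).map b = (proj P T).map b' := by
        rw [← cancel_mono ((proj P T).map f), ← Functor.map_comp, ← Functor.map_comp]
        congr 1
        ext
        exact haa
      rw [proj_map_eq_iff h.right, h.factorsThrough_iff] at hbb
      -- As `X` lies in `Σ⁻¹S`, testing on its identity turns equality modulo `[T]` into equality.
      have := hbb X hX (𝟙 X)
      rw [Category.id_comp, sub_eq_zero] at this
      exact this
    · intro a
      -- Epicness makes the cone map `g` zero modulo `[T]`, so it is killed by `a`, which therefore
      -- lifts along `f`.
      obtain ⟨K, g, k, hK⟩ := distinguished_cocone_triangle f.hom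
      have hfg : f.hom ≫ g = 0 := comp_distTriang_mor_zero₁₂ _ hK
      let b : Z ⟶ (⟨K, hP' K⟩ : P.FullSubcategory) := ObjectProperty.homMk g
      let b' : Z ⟶ (⟨K, hP' K⟩ : P.FullSubcategory) := ObjectProperty.homMk 0
      have hbb : (proj P T).map b = (proj P T).map b' := by
        rw [← cancel_epi ((proj P T).map f), ← Functor.map_comp, ← Functor.map_comp]
        congr 1
        ext
        exact hfg.trans comp_zero.symm
      rw [proj_map_eq_iff h.right, h.factorsThrough_iff] at hbb
      have hag : a ≫ g = 0 := by
        have := hbb X hX a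
        rwa [show b.hom - b'.hom = g from sub_zero g] at this
      obtain ⟨c, hc⟩ := Triangle.coyoneda_exact₂ _ hK a hag
      exact ⟨c, hc.symm⟩
  · intro hf
    refine ⟨⟨fun {X} g g' hgg => ?_⟩, ⟨fun {X} g g' hgg => ?_⟩⟩
    · obtain ⟨g, rfl⟩ := (proj P T).map_surjective (X := X.as) (Y := Y) g
      obtain ⟨g', rfl⟩ := (proj P T).map_surjective (X := X.as) (Y := Y) g'
      have hgg := (h.factorsThrough_iff _).1 (hcomp.1 hgg)
      refine (proj_map_eq_iff h.right _ _).2 ((h.factorsThrough_iff _).2 fun A hA a => ?_)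
      apply (hf A hA).1
      dsimp only
      rw [Category.assoc, hgg A hA a, zero_comp]
    · obtain ⟨g, rfl⟩ := (proj P T).map_surjective (X := Z) (Y := X.as) g
      obtain ⟨g', rfl⟩ := (proj P T).map_surjective (X := Z) (Y := X.as) g'
      have hgg := (h.factorsThrough_iff _).1 (hcomp'.1 hgg)
      refine (proj_map_eq_iff h.right _ _).2 ((h.factorsThrough_iff _).2 fun A hA a => ?_)
      obtain ⟨b, rfl⟩ := (hf A hA).2 a
      dsimp only
      rw [Category.assoc, hgg A hA b]

/-- For a cotorsion pair `(S, T)` with `S ⊆ T`, the canonical functor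
`(Σ⁻¹S * S) / [S] ⥤ C / [T]` is an equivalence after localising at the regular morphisms. -/
lemma IsCotorsionPair.isEquivalence_localization (h : IsCotorsionPair S T) (hST : S ≤ T)
    {P P' W W' : ObjectProperty C} (hP : P = star (susp (-1) S) S) (hP' : P' = ⊤)
    (hW : W = S) (hW' : W' = T) (hPP : P ≤ P') (hWW : W ≤ W') :
    (subfactorFunctor hPP hWW ⋙ (regularMorphisms (Subfactor P' W')).Q).IsEquivalence := by
  subst hW hW'
  have hmem (X : C) : P' X := by rw [hP']; trivial
  have hstar (X : P.FullSubcategory) : star (susp (-1) W) W X.obj := hP ▸ X.property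
  let F : Subfactor P W ⥤ Subfactor P' W' := subfactorFunctor hPP hWW
  have hF {X Y : P.FullSubcategory} (f : X ⟶ Y) :
      F.map ((proj P W).map f) = (proj P' W').map ((ObjectProperty.ιOfLE hPP).map f) := rfl
  have : F.Full := ⟨fun {X Y} f => by
    obtain ⟨f, rfl⟩ := (proj P' W').map_surjective
      (X := (ObjectProperty.ιOfLE hPP).obj X.as) (Y := (ObjectProperty.ιOfLE hPP).obj Y.as) f
    exact ⟨(proj P W).map (ObjectProperty.homMk f.hom), rfl⟩⟩
  have : F.Faithful := ⟨fun {X Y} f g hfg => by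
    obtain ⟨f, rfl⟩ := (proj P W).map_surjective (X := X.as) (Y := Y.as) f
    obtain ⟨g, rfl⟩ := (proj P W).map_surjective (X := X.as) (Y := Y.as) g
    exact (proj_map_eq_iff h.left _ _).2 (h.factorsThrough_of_star (hstar X.as)
      ((proj_map_eq_iff h.right ((ObjectProperty.ιOfLE hPP).map f)
        ((ObjectProperty.ιOfLE hPP).map g)).1 hfg))⟩
  refine isEquivalence_comp_Q_of_colocal F _ (fun X Y Y' f hf => ?_) (fun Y => ?_)
  · obtain ⟨f, rfl⟩ := (proj P' W').map_surjective (X := Y.as) (Y := Y'.as) f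
    refine ⟨fun g g' hgg => ?_, fun m => ?_⟩
    · have : Mono ((proj P' W').map f) := hf.1
      exact (cancel_mono ((proj P' W').map f)).1 hgg
    · rw [h.regularMorphisms_iff hP'] at hf
      obtain ⟨m, rfl⟩ := (proj P' W').map_surjective
        (X := (ObjectProperty.ιOfLE hPP).obj X.as) (Y := Y'.as) m
      obtain ⟨l, hl⟩ := exists_lift_of_homBijective hST (hstar X.as) hf m.hom
      let l' : (ObjectProperty.ιOfLE hPP).obj X.as ⟶ Y.as := ObjectProperty.homMk l
      refine ⟨(proj P' W').map l', ?_⟩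
      exact ((proj P' W').map_comp l' f).symm.trans ((proj_map_eq_iff h.right (l' ≫ f) m).2 hl)
  · obtain ⟨X, c, hX, hc⟩ := h.exists_homBijective hST Y.as.obj
    let X' : P.FullSubcategory := ⟨X, by rwa [hP]⟩
    let c' : (ObjectProperty.ιOfLE hPP).obj X' ⟶ Y.as := ObjectProperty.homMk c
    exact ⟨(proj P W).obj X', (proj P' W').map c', (h.regularMorphisms_iff hP' c').2 hc⟩

end Rigid

end TwinCotorsion

theorem theorem4p9 {C : Type u} [Category.{v} C] [Preadditive C] [HasZeroObject C]
    [HasShift C ℤ] [∀ n : ℤ, (shiftFunctor C n).Additive] [Pretriangulated C]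
    [IsTriangulated C] (hKS : TwinCotorsion.IsKrullSchmidt C)
    (S T U V : ObjectProperty C) (hSTUV : TwinCotorsion.IsTwinCotorsionPair S T U V)
    (hTU : T = U) :
    -- the heart of the twin cotorsion pair is `C / [W]` with `W = T`
    TwinCotorsion.twinW T U = T ∧
    TwinCotorsion.twinH S T U V = ⊤ ∧
    -- the heart of `(S, T)` is `(Σ⁻¹S * S) / [S]`
    TwinCotorsion.pairW S T = S ∧
    TwinCotorsion.pairH S T =
      TwinCotorsion.star (TwinCotorsion.susp (-1) S) S ∧
    -- the canonical functor followed by the localisation functor is an equivalence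
    ∃ (hH : TwinCotorsion.pairH S T ≤ TwinCotorsion.twinH S T U V)
      (hW : TwinCotorsion.pairW S T ≤ TwinCotorsion.twinW T U),
      Functor.IsEquivalence
        ((TwinCotorsion.subfactorFunctor hH hW :
            TwinCotorsion.PairHeart S T ⥤ TwinCotorsion.TwinHeart S T U V) ⋙
          (TwinCotorsion.regularMorphisms (TwinCotorsion.TwinHeart S T U V)).Q) := by
  subst hTU
  have hST : S ≤ T := fun X hX => hSTUV.snd.left_of_ext fun Y hY f => hSTUV.ext X Y hX hY f
  have hW : TwinCotorsion.twinW T T = T := inf_idem T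
  have hH : TwinCotorsion.twinH S T T V = ⊤ := by
    -- `T * ΣV` is everything by the second pair, and `Σ⁻¹S * T` by desuspending the first.
    rw [TwinCotorsion.twinH, hW, hSTUV.snd.star_eq, inf_top_eq, eq_top_iff]
    exact fun X _ => hSTUV.fst.star_susp_neg_one X
  have hpW : TwinCotorsion.pairW S T = S := inf_eq_left.2 hST
  have hpH : TwinCotorsion.pairH S T =
      TwinCotorsion.star (TwinCotorsion.susp (-1) S) S := by
    rw [TwinCotorsion.pairH, hpW, hSTUV.fst.star_eq, inf_top_eq]
  refine ⟨hW, hH, hpW, hpH, by rw [hH]; exact le_top, by rw [hpW, hW]; exact hST, ?_⟩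
  exact hSTUV.fst.isEquivalence_localization hST hpH hH hpW hW _ _
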